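/- Let $T$ be a nonsingular real $n\times n$ matrix with $\lambda(T)=\inf_{k\ge 1}\|T^k\|^{1/k}<1$, let $q\ge 1$ and $d_1,\dots,d_q\in\mathbb{R}^n$ with $d_1=0$, and let $F\subset\mathbb{R}^n$ be the nonempty compact set satisfying $F=\bigcup_{j=1}^q T(F+d_j)$. For $i\ge 1$ put $$A_i=\{T d_{j_1}+T^2 d_{j_2}+\cdots+T^i d_{j_i} : 1\le j_1,\dots,j_i\le q\},$$ let $\mathcal V_i$ be the set of vertices (extreme points) of the convex hull $\operatorname{conv}(A_i)$, and let $\#\mathcal V_i$ be its number of elements. Let $U$ be the set of all complex eigenvalues of $T^{-1}$ of the form $cz$ with $c\ge 0$ real and $z$ a root of unity, and assume $U\ne\emptyset$. Write $$U=\{c_1 z_1,\dots,c_m z_m\},\qquad c_s\ge 0,\quad z_s^{2n_s}=1,$$ with integers $n_s\ge 1$, and set $k=2n_1n_2\cdots n_m$. If $\#\mathcal V_i\ne\#\mathcal V_{i+1}$ for all $1\le i\le k$, then $\operatorname{conv}(F)$ is not a polytope (that is, not the convex hull of a finite set). Consequently, $\operatorname{conv}(F)$ is a polytope if and only if $\#\mathcal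 V_i=\#\mathcal V_{i+1}$ for some $1\le i\le k$. -/

import Mathlib

namespace SelfAffine

/-- The linear map `x ↦ M x` of a real `n × n` matrix on Euclidean space. -/
noncomputable abbrev act {n : ℕ} (M : Matrix (Fin n) (Fin n) ℝ) :
    EuclideanSpace ℝ (Fin n) →L[ℝ] EuclideanSpace ℝ (Fin n) :=
  Matrix.toEuclideanCLM (n := Fin n) (𝕜 := ℝ) M

/-- The product `T_{j_1} T_{j_2} ⋯ T_{j_k}` along a multi-index `j` of length `k`. -/
def wordProd {n q : ℕ} (T : Fin q → Matrix (Fin n) (Fin n) ℝ) {k : ℕ} (j : Fin k → Fin q) :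
    Matrix (Fin n) (Fin n) ℝ :=
  (List.ofFn fun i => T (j i)).prod

/-- The joint spectral radius `inf_{k ≥ 1} (max_{|j| = k} ‖T_{j_1} ⋯ T_{j_k}‖) ^ (1 / k)`, where
`‖·‖` is the matrix norm induced by the Euclidean norm. -/
noncomputable def jointSpectralRadius {n q : ℕ} (T : Fin q → Matrix (Fin n) (Fin n) ℝ) : ℝ :=
  ⨅ k : ℕ+, (⨆ j : Fin (k : ℕ) → Fin q, ‖act (wordProd T j)‖) ^ (1 / ((k : ℕ) : ℝ))

/-- `F` is a nonempty compact set with `F = ⋃ j, T_j (F + d_j)`. -/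
structure IsSelfAffineSet {n q : ℕ} (T : Fin q → Matrix (Fin n) (Fin n) ℝ)
    (d : Fin q → EuclideanSpace ℝ (Fin n)) (F : Set (EuclideanSpace ℝ (Fin n))) : Prop where
  nonempty : F.Nonempty
  isCompact : IsCompact F
  eq_iUnion : F = ⋃ j : Fin q, (fun x => act (T j) (x + d j)) '' F

/-- The set `A_k` of all sums
`T_{j_1} d_{j_1} + T_{j_1} T_{j_2} d_{j_2} + ⋯ + T_{j_1} T_{j_2} ⋯ T_{j_k} d_{j_k}`. -/
def approx {n q : ℕ} (T : Fin q → Matrix (Fin n) (Fin n) ℝ)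
    (d : Fin q → EuclideanSpace ℝ (Fin n)) (k : ℕ) : Set (EuclideanSpace ℝ (Fin n)) :=
  {x | ∃ j : Fin k → Fin q,
    x = ∑ i : Fin k,
      act (wordProd T fun l : Fin ((i : ℕ) + 1) => j (Fin.castLE i.isLt l)) (d (j i))}

/-- The set `V_k` of vertices of the convex hull of `A_k`. -/
def vertices {n q : ℕ} (T : Fin q → Matrix (Fin n) (Fin n) ℝ)
    (d : Fin q → EuclideanSpace ℝ (Fin n)) (k : ℕ) : Set (EuclideanSpace ℝ (Fin n)) :=
  (convexHull ℝ (approx T d k)).extremePoints ℝ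

/-- A polytope is the convex hull of a finite set of points. -/
def IsPolytope {n : ℕ} (P : Set (EuclideanSpace ℝ (Fin n))) : Prop :=
  ∃ S : Set (EuclideanSpace ℝ (Fin n)), S.Finite ∧ P = convexHull ℝ S

/-- The set `U` of all complex eigenvalues of `T⁻¹` of the form `c * z` with `c ≥ 0` real and `z`
a root of unity. -/
def unityEigenvalues {n : ℕ} (T : Matrix (Fin n) (Fin n) ℝ) : Set ℂ :=
  {u | Module.End.HasEigenvalue (Matrix.toLin' (T⁻¹.map ((↑) : ℝ → ℂ))) u ∧
    ∃ (c : ℝ) (z : ℂ) (N : ℕ), 0 ≤ c ∧ 1 ≤ N ∧ z ^ N = 1 ∧ u = (c : ℂ) * z}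

end SelfAffine

/-! Write `L` for the map of `T` and `D` for the set of digits `d_j`. Then `A_i` is the Minkowski
sum `L D + ⋯ + L^i D`, and `F = A_i + L^i F`.

Adding a polytope never loses vertices, and the count stays the same exactly when the normal fan of
the first summand refines that of the second (`ncard_extremePoints_add_eq_iff`). Applying `L` to
such a refinement and adding `L D` gives it at the next index, so one equality persists forever. The
hulls of the `A_i` then have a bounded number of vertices and converge to the hull of `F`, which is
a polytope (`exists_finite_convexHull_eq`).

Conversely, let the hull of `F` be a polytope. Each `L^i D`, `i ≥ 1`, is a Minkowski summand of `F`,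
so its edges take only finitely many directions, and by pigeonhole every edge vector `e` of `D` is
an eigenvector of some `L^N`. The eigenvalues of `T⁻¹` involved in `e` have a common real `N`-th
power, so they lie in `U` and share one modulus. The choice of `k` makes their `k`-th powers equal
and positive, so `L^k` scales `e` positively. A vertex cone is generated by edges, so the fan of `D`
refines that of `L^k D`. After applying `L`, equality holds at `i = k`. -/

namespace SelfAffine

open Set Filter Topology Pointwise

variable {E : Type*} [NormedAddCommGroup E] [NormedSpace ℝ E]

/-! ### Unique maximizers and vertices -/

/-- `a` is the unique maximizer of the functional `φ` on `A`. -/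
def UniqueMax (φ : StrongDual ℝ E) (A : Set E) (a : E) : Prop :=
  a ∈ A ∧ ∀ b ∈ A, b ≠ a → φ b < φ a

theorem UniqueMax.le {φ : StrongDual ℝ E} {A : Set E} {a b : E} (h : UniqueMax φ A a)
    (hb : b ∈ A) : φ b ≤ φ a := by
  by_cases hab : b = a
  · rw [hab]
  · exact (h.2 b hb hab).le

theorem UniqueMax.eq_of_le {φ : StrongDual ℝ E} {A : Set E} {a b : E} (h : UniqueMax φ A a)
    (hb : b ∈ A) (hle : φ a ≤ φ b) : b = a := by
  by_contra hab
  exact (h.2 b hb hab).not_ge hle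

theorem UniqueMax.convexHull_right {φ : StrongDual ℝ E} {A : Set E} {a : E} (h : UniqueMax φ A a) :
    UniqueMax φ (convexHull ℝ A) a := by
  refine ⟨subset_convexHull ℝ A h.1, ?_⟩
  have hconv : Convex ℝ {x : E | x ≠ a → φ x < φ a} := by
    intro x hx y hy s t hs ht hst hne
    have hle : ∀ w : E, (w ≠ a → φ w < φ a) → φ w ≤ φ a := by
      intro w hw
      by_cases hwa : w = a
      · rw [hwa]
      · exact (hw hwa).le
    have hx' := hle x hx
    have hy' := hle y hy
    have hsum : φ a = s * φ a + t * φ a := by rw [← add_mul, hst, one_mul]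
    simp only [map_add, map_smul, smul_eq_mul]
    rw [hsum]
    rcases hs.eq_or_lt with rfl | hs
    · obtain rfl : t = 1 := by linarith
      have : y ≠ a := by simpa using hne
      have := hy this
      linarith
    rcases ht.eq_or_lt with rfl | ht
    · obtain rfl : s = 1 := by linarith
      have : x ≠ a := by simpa using hne
      have := hx this
      linarith
    by_cases hxa : x = a
    · by_cases hya : y = a
      · refine absurd ?_ hne
        rw [hxa, hya, ← add_smul, hst, one_smul]
      · have := mul_lt_mul_of_pos_left (hy hya) ht
        have := mul_le_mul_of_nonneg_left hx' hs.le
        linarith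
    · have := mul_lt_mul_of_pos_left (hx hxa) hs
      have := mul_le_mul_of_nonneg_left hy' ht.le
      linarith
  intro b hb
  exact convexHull_min (fun x hx => h.2 x hx) hconv hb

theorem UniqueMax.mem_extremePoints {φ : StrongDual ℝ E} {A : Set E} {a : E}
    (h : UniqueMax φ A a) : a ∈ (convexHull ℝ A).extremePoints ℝ := by
  have h' := h.convexHull_right
  rw [_root_.mem_extremePoints]
  refine ⟨h'.1, ?_⟩
  rintro x hx y hy ⟨s, t, hs, ht, hst, rfl⟩
  have hx' := h'.le hx
  have hy' := h'.le hy
  have hval : φ (s • x + t • y) = s * φ x + t * φ y := by simp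
  have hsum : φ (s • x + t • y) = s * φ (s • x + t • y) + t * φ (s • x + t • y) := by
    rw [← add_mul, hst, one_mul]
  constructor
  · by_contra hne
    have h1 := mul_lt_mul_of_pos_left (h'.2 x hx hne) hs
    have h2 := mul_le_mul_of_nonneg_left hy' ht.le
    linarith
  · by_contra hne
    have h1 := mul_lt_mul_of_pos_left (h'.2 y hy hne) ht
    have h2 := mul_le_mul_of_nonneg_left hx' hs.le
    linarith

/-- An extreme point lies outside the hull of the other points, which is compact because `A` is
finite, so a functional separates it strictly. -/
theorem mem_extremePoints_convexHull_iff {A : Set E} (hA : A.Finite) {a : E} :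
    a ∈ (convexHull ℝ A).extremePoints ℝ ↔ ∃ φ : StrongDual ℝ E, UniqueMax φ A a := by
  refine ⟨fun ha => ?_, fun ⟨φ, hφ⟩ => hφ.mem_extremePoints⟩
  have haA : a ∈ A := extremePoints_convexHull_subset ha
  have hnot : a ∉ convexHull ℝ (A \ {a}) := by
    intro hmem
    have hconv := (convex_convexHull ℝ A).mem_extremePoints_iff_convex_sdiff.1 ha
    have hsub : A \ {a} ⊆ convexHull ℝ A \ {a} :=
      sdiff_subset_sdiff_left (subset_convexHull ℝ A)
    exact (convexHull_min hsub hconv.2 hmem).2 rfl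
  obtain ⟨f, u, hfu, hf⟩ := geometric_hahn_banach_closed_point
    (convex_convexHull ℝ (A \ {a})) (hA.sdiff.isCompact_convexHull ℝ).isClosed hnot
  exact ⟨f, haA, fun b hb hba => (hfu b (subset_convexHull ℝ _ ⟨hb, hba⟩)).trans hf⟩

theorem uniqueMax_add_iff {φ : StrongDual ℝ E} {A B : Set E} {c : E} :
    UniqueMax φ (A + B) c ↔ ∃ a b, a + b = c ∧ UniqueMax φ A a ∧ UniqueMax φ B b := by
  constructor
  · rintro ⟨⟨a, ha, b, hb, rfl⟩, h⟩
    refine ⟨a, b, rfl, ⟨ha, fun x hx hxa => ?_⟩, ⟨hb, fun x hx hxb => ?_⟩⟩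
    · have := h (x + b) (add_mem_add hx hb) (by simpa using hxa)
      simpa using this
    · have := h (a + x) (add_mem_add ha hx) (by simpa using hxb)
      simpa using this
  · rintro ⟨a, b, rfl, ha, hb⟩
    refine ⟨add_mem_add ha.1 hb.1, ?_⟩
    rintro _ ⟨x, hx, y, hy, rfl⟩ hne
    simp only [map_add]
    by_cases hxa : x = a
    · subst hxa
      have := hb.2 y hy (by rintro rfl; exact hne rfl)
      linarith
    · have := ha.2 x hx hxa
      have := hb.le hy
      linarith

theorem uniqueMax_image_iff {φ : StrongDual ℝ E} {A : Set E} {f : E →L[ℝ] E}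
    (hf : Function.Injective f) {a : E} :
    UniqueMax φ (f '' A) (f a) ↔ UniqueMax (φ.comp f) A a := by
  constructor
  · rintro ⟨⟨b, hb, hba⟩, h⟩
    rw [hf hba] at hb
    exact ⟨hb, fun x hx hxa => h (f x) (mem_image_of_mem f hx) (hf.ne hxa)⟩
  · rintro ⟨ha, h⟩
    refine ⟨mem_image_of_mem f ha, ?_⟩
    rintro _ ⟨x, hx, rfl⟩ hne
    exact h x hx (by rintro rfl; exact hne rfl)

/-! ### Normal fans, generic functionals and vertex counts -/

/-- The normal fan of `A` refines the one of `B`: generic functionals with the same maximizer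
on `A` have the same maximizer on `B`. -/
def FanRefines (A B : Set E) : Prop :=
  ∀ ⦃φ ψ : StrongDual ℝ E⦄ ⦃a b b' : E⦄, UniqueMax φ A a → UniqueMax ψ A a →
    UniqueMax φ B b → UniqueMax ψ B b' → b = b'

theorem FanRefines.image {A B : Set E} (h : FanRefines A B) {f : E →L[ℝ] E}
    (hf : Function.Injective f) : FanRefines (f '' A) (f '' B) := by
  intro φ ψ a b b' ha ha' hb hb'
  obtain ⟨a, -, rfl⟩ := ha.1
  obtain ⟨b, -, rfl⟩ := hb.1
  obtain ⟨b', -, rfl⟩ := hb'.1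
  rw [uniqueMax_image_iff hf] at *
  rw [h ha ha' hb hb']

/-- A vertex of `C + A` determines its summand in `A`. -/
theorem FanRefines.add_left {A B : Set E} (h : FanRefines A B) (C : Set E) :
    FanRefines (C + A) B := by
  intro φ ψ x b b' hx hx' hb hb'
  obtain ⟨c, a, rfl, hc, ha⟩ := uniqueMax_add_iff.1 hx
  obtain ⟨c', a', hca, hc', ha'⟩ := uniqueMax_add_iff.1 hx'
  have haa : a' = a := by
    by_contra hne
    have h1 := ha.2 a' ha'.1 hne
    have h2 := hc.le hc'.1
    have h3 := congrArg φ hca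
    simp only [map_add] at h3
    linarith
  subst haa
  exact h ha ha' hb hb'

/-- Over an infinite field, the annihilator of `f` is not a finite union of proper subspaces. -/
theorem exists_dual_ne_zero_of_notMem_span [FiniteDimensional ℝ E] (f : E) {Δ : Set E}
    (hΔ : Δ.Finite) (h : ∀ δ ∈ Δ, δ ∉ Submodule.span ℝ {f}) :
    ∃ ζ : StrongDual ℝ E, ζ f = 0 ∧ ∀ δ ∈ Δ, ζ δ ≠ 0 := by
  have := hΔ.to_subtype
  obtain ⟨ζ, hζ, hne⟩ := Module.Dual.exists_forall_mem_ne_zero_of_forall_exists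
    (LinearMap.ker (Module.Dual.eval ℝ E f)) (fun δ : Δ => Module.Dual.eval ℝ E (δ : E)) (by
      rintro ⟨δ, hδ⟩
      obtain ⟨g, hg, hle⟩ := Submodule.exists_le_ker_of_notMem (h δ hδ)
      exact ⟨g, hle (Submodule.mem_span_singleton_self f), hg⟩)
  exact ⟨LinearMap.toContinuousLinearMap ζ, hζ, fun δ hδ => hne ⟨δ, hδ⟩⟩

theorem eventually_add_mul_pos {x y : ℝ} (hx : 0 < x) : ∀ᶠ t : ℝ in 𝓝[>] 0, 0 < x + t * y := by
  have hc : Continuous fun t : ℝ => x + t * y := by fun_prop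
  have : ∀ᶠ t : ℝ in 𝓝 0, 0 < x + t * y :=
    hc.continuousAt.eventually (by simpa using lt_mem_nhds hx)
  exact this.filter_mono nhdsWithin_le_nhds

theorem UniqueMax.eventually_perturb {φ : StrongDual ℝ E} {A : Set E} {a : E} (hA : A.Finite)
    (h : UniqueMax φ A a) (ψ : StrongDual ℝ E) :
    ∀ᶠ t : ℝ in 𝓝[>] 0, UniqueMax (φ + t • ψ) A a := by
  have : ∀ᶠ t : ℝ in 𝓝[>] 0, ∀ b ∈ A, b ≠ a → (φ + t • ψ) b < (φ + t • ψ) a := by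
    rw [eventually_all_finite hA]
    intro b hb
    by_cases hba : b = a
    · simp [hba]
    filter_upwards [eventually_add_mul_pos (y := ψ a - ψ b) (sub_pos.2 (h.2 b hb hba))] with t ht _
    simp only [add_apply, smul_apply, smul_eq_mul]
    linarith
  filter_upwards [this] with t ht
  exact ⟨h.1, ht⟩

/-- For small `t > 0` the maximum is lexicographic: `φ` decides first, and `ψ` breaks ties. -/
theorem exists_eventually_uniqueMax {A : Set E} (hA : A.Finite) (hne : A.Nonempty)
    (φ : StrongDual ℝ E) {ψ : StrongDual ℝ E} (hψ : InjOn ψ A) :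
    ∃ a, ∀ᶠ t : ℝ in 𝓝[>] 0, UniqueMax (φ + t • ψ) A a := by
  obtain ⟨m, hm, hmax⟩ := exists_max_image A φ hA hne
  obtain ⟨a, ⟨ha, hφa⟩, hamax⟩ := exists_max_image {x ∈ A | φ x = φ m} ψ (hA.sep _) ⟨m, hm, rfl⟩
  refine ⟨a, ?_⟩
  have : ∀ᶠ t : ℝ in 𝓝[>] 0, ∀ b ∈ A, b ≠ a → (φ + t • ψ) b < (φ + t • ψ) a := by
    rw [eventually_all_finite hA]
    intro b hb
    by_cases hba : b = a
    · simp [hba]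
    rcases (hmax b hb).eq_or_lt with hbm | hbm
    · have h1 : ψ b < ψ a := lt_of_le_of_ne (hamax b ⟨hb, hbm⟩) (fun h => hba (hψ hb ha h))
      filter_upwards [self_mem_nhdsWithin] with t ht _
      have := mul_lt_mul_of_pos_left h1 ht
      simp only [add_apply, smul_apply, smul_eq_mul]
      linarith
    · rw [← hφa] at hbm
      filter_upwards [eventually_add_mul_pos (y := ψ a - ψ b) (sub_pos.2 hbm)] with t ht _
      simp only [add_apply, smul_apply, smul_eq_mul]
      linarith
  filter_upwards [this] with t ht
  exact ⟨ha, ht⟩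

theorem UniqueMax.exists_common [FiniteDimensional ℝ E] {φ : StrongDual ℝ E} {A B : Set E} {a : E}
    (hA : A.Finite) (hB : B.Finite) (hne : B.Nonempty) (h : UniqueMax φ A a) :
    ∃ (ψ : StrongDual ℝ E) (b : E), UniqueMax ψ A a ∧ UniqueMax ψ B b := by
  obtain ⟨ζ, -, hζ⟩ := exists_dual_ne_zero_of_notMem_span (0 : E) (Δ := (B - B) \ {0})
    (hB.sub hB).sdiff (fun δ hδ => by simpa using hδ.2)
  have hinj : InjOn ζ B := by
    intro x hx y hy hxy
    by_contra hne
    exact hζ (x - y) ⟨sub_mem_sub hx hy, by simpa [sub_eq_zero] using hne⟩ (by simp [hxy])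
  obtain ⟨b, hb⟩ := exists_eventually_uniqueMax hB hne φ hinj
  obtain ⟨t, ht⟩ := ((h.eventually_perturb hA ζ).and hb).exists
  exact ⟨_, b, ht⟩

/-- Take the pairs of vertices of `A` and `B` exposed by a common functional. Addition maps them
bijectively to the vertices of `A + B`, the first projection maps them onto those of `A`. The counts
agree iff this projection is injective, which is refinement of fans. -/
theorem ncard_extremePoints_add_eq_iff [FiniteDimensional ℝ E] {A B : Set E} (hA : A.Finite)
    (hB : B.Finite) (hne : B.Nonempty) :
    ((convexHull ℝ A).extremePoints ℝ).ncard = ((convexHull ℝ (A + B)).extremePoints ℝ).ncard ↔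
      FanRefines A B := by
  set W : Set (E × E) := {p | ∃ φ : StrongDual ℝ E, UniqueMax φ A p.1 ∧ UniqueMax φ B p.2} with hW
  have hWfin : W.Finite := (hA.prod hB).subset fun p ⟨φ, h1, h2⟩ => ⟨h1.1, h2.1⟩
  have hfst : Prod.fst '' W = (convexHull ℝ A).extremePoints ℝ := by
    ext a
    rw [mem_extremePoints_convexHull_iff hA]
    constructor
    · rintro ⟨p, ⟨φ, h1, -⟩, rfl⟩
      exact ⟨φ, h1⟩
    · rintro ⟨φ, hφ⟩
      obtain ⟨ψ, b, h1, h2⟩ := hφ.exists_common hA hB hne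
      exact ⟨(a, b), ⟨ψ, h1, h2⟩, rfl⟩
  have hadd : (fun p : E × E => p.1 + p.2) '' W = (convexHull ℝ (A + B)).extremePoints ℝ := by
    ext c
    rw [mem_extremePoints_convexHull_iff (hA.add hB)]
    simp only [uniqueMax_add_iff]
    constructor
    · rintro ⟨p, ⟨φ, h1, h2⟩, rfl⟩
      exact ⟨φ, p.1, p.2, rfl, h1, h2⟩
    · rintro ⟨φ, a, b, rfl, h1, h2⟩
      exact ⟨(a, b), ⟨φ, h1, h2⟩, rfl⟩
  have hinj : InjOn (fun p : E × E => p.1 + p.2) W := by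
    rintro ⟨a, b⟩ ⟨φ, h1, h2⟩ ⟨a', b'⟩ ⟨φ', h1', h2'⟩ heq
    simp only at heq h1 h2 h1' h2'
    have haa : a' = a := by
      refine h1.eq_of_le h1'.1 ?_
      have h3 := h2.le h2'.1
      have h4 := congrArg φ heq
      simp only [map_add] at h4
      linarith
    subst haa
    rw [add_left_cancel heq]
  rw [← hfst, ← hadd, hinj.ncard_image, ncard_image_iff hWfin]
  constructor
  · intro h φ ψ a b b' h1 h2 h3 h4
    exact congrArg Prod.snd (h (x₁ := (a, b)) ⟨φ, h1, h3⟩ (x₂ := (a, b')) ⟨ψ, h2, h4⟩ rfl)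
  · rintro h ⟨a, b⟩ ⟨φ, h1, h2⟩ ⟨a', b'⟩ ⟨φ', h1', h2'⟩ heq
    simp only at heq h1 h2 h1' h2'
    subst heq
    rw [h h1 h1' h2 h2']

theorem convexHull_extremePoints_convexHull {A : Set E} (hA : A.Finite) :
    convexHull ℝ ((convexHull ℝ A).extremePoints ℝ) = convexHull ℝ A := by
  have h := closure_convexHull_extremePoints (hA.isCompact_convexHull ℝ) (convex_convexHull ℝ A)
  rwa [IsClosed.closure_eq] at h
  exact ((hA.subset extremePoints_convexHull_subset).isCompact_convexHull ℝ).isClosed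

/-! ### Edges of polytopes and of their Minkowski summands -/

/-- `e` is parallel to a one-dimensional face of `convexHull ℝ D`. -/
def IsEdgeVector (D : Set E) (e : E) : Prop :=
  e ≠ 0 ∧ ∃ a ∈ D, a + e ∈ D ∧ ∃ η : StrongDual ℝ E, η e = 0 ∧
    ∀ x ∈ D, η x < η a ∨ ∃ c : ℝ, x = a + c • e

theorem IsEdgeVector.image [FiniteDimensional ℝ E] {D : Set E} {e : E} (h : IsEdgeVector D e)
    {f : E →L[ℝ] E} (hf : Function.Injective f) : IsEdgeVector (f '' D) (f e) := by
  obtain ⟨he, a, ha, hae, η, hηe, hη⟩ := h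
  obtain ⟨η', hη'⟩ := LinearMap.dualMap_surjective_of_injective (f := f.toLinearMap) hf
    η.toLinearMap
  have key : ∀ x, η' (f x) = η x := fun x => LinearMap.congr_fun hη' x
  refine ⟨fun h0 => he (hf (by simpa using h0)), f a, mem_image_of_mem f ha,
    ⟨a + e, hae, map_add f a e⟩, LinearMap.toContinuousLinearMap η', ?_, ?_⟩
  · simpa [key] using hηe
  · rintro _ ⟨x, hx, rfl⟩
    rcases hη x hx with h | ⟨c, rfl⟩
    · exact Or.inl (by simpa [key] using h)
    · exact Or.inr ⟨c, by simp⟩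

/-- The cone of a polytope at a vertex is generated by the edges at this vertex. -/
theorem UniqueMax.le_of_forall_isEdgeVector {φ g : StrongDual ℝ E} {D : Set E} {a : E}
    (hD : D.Finite) (h : UniqueMax φ D a)
    (hg : ∀ x ∈ D, φ x < φ a → IsEdgeVector D (x - a) → g (x - a) ≤ 0) {b : E} (hb : b ∈ D) :
    g b ≤ g a := by
  -- Vertex figure: `p` projects `D \ {a}` from `a` to the hyperplane `φ = -1`, where edges at `a`
  -- become vertices.
  set p : E → E := fun x => (φ a - φ x)⁻¹ • (x - a) with hp
  set B : Set E := p '' (D \ {a}) with hB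
  have hBfin : B.Finite := hD.sdiff.image p
  have hext : ∀ y ∈ (convexHull ℝ B).extremePoints ℝ, g y ≤ 0 := by
    intro y hy
    obtain ⟨η₀, hη₀⟩ := (mem_extremePoints_convexHull_iff hBfin).1 hy
    obtain ⟨w, ⟨hw, hwa⟩, rfl⟩ := hη₀.1
    have hpos : 0 < φ a - φ w := sub_pos.2 (h.2 w hw hwa)
    simp only [hp, map_smul, smul_eq_mul]
    refine mul_nonpos_of_nonneg_of_nonpos (inv_nonneg.2 hpos.le)
      (hg w hw (h.2 w hw hwa) ⟨sub_ne_zero.2 hwa, a, h.1, by simpa using hw,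
        -- The multiple of `φ` is chosen so that the functional vanishes on `w - a`.
        η₀ + η₀ (p w) • φ, ?_, ?_⟩)
    · simp only [hp, add_apply, smul_apply, map_smul,
        smul_eq_mul, map_sub]
      field_simp
      ring
    · intro x hx
      by_cases hxa : x = a
      · exact Or.inr ⟨0, by simp [hxa]⟩
      have hxpos : 0 < φ a - φ x := sub_pos.2 (h.2 x hx hxa)
      by_cases hxw : p x = p w
      · refine Or.inr ⟨(φ a - φ x) * (φ a - φ w)⁻¹, ?_⟩
        have : x - a = (φ a - φ x) • p x := by
          rw [hp, smul_smul, mul_inv_cancel₀ hxpos.ne', one_smul]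
        rw [mul_smul, ← sub_eq_iff_eq_add', this, hxw]
      · left
        have hlt := hη₀.2 (p x) (mem_image_of_mem p ⟨hx, hxa⟩) hxw
        have hpx : η₀ (p x) * (φ a - φ x) = η₀ x - η₀ a := by
          simp only [hp, map_smul, smul_eq_mul, map_sub]
          field_simp
        have := mul_lt_mul_of_pos_right hlt hxpos
        simp only [add_apply, smul_apply, smul_eq_mul]
        linarith
  have hall : ∀ y ∈ convexHull ℝ B, g y ≤ 0 := by
    rw [← convexHull_extremePoints_convexHull hBfin]
    exact fun y hy => convexHull_min (t := {y | g y ≤ 0}) hext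
      (convex_halfSpace_le g.toLinearMap.isLinear 0) hy
  by_cases hba : b = a
  · rw [hba]
  have hpos : 0 < φ a - φ b := sub_pos.2 (h.2 b hb hba)
  have := hall (p b) (subset_convexHull ℝ B (mem_image_of_mem p ⟨hb, hba⟩))
  simp only [hp, map_smul, smul_eq_mul, map_sub] at this
  have := nonpos_of_mul_nonpos_right this (inv_pos.2 hpos)
  linarith

/-- An edge of a Minkowski summand of a polytope is parallel to a difference of vertices. -/
theorem IsEdgeVector.exists_sub_mem_span [FiniteDimensional ℝ E] {Q R S : Set E} {e : E}
    (h : IsEdgeVector Q e) (hQ : Q.Finite) (hR : IsCompact R) (hRne : R.Nonempty)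
    (hS : S.Finite) (hSne : S.Nonempty) (hconv : convexHull ℝ (Q + R) = convexHull ℝ S) :
    ∃ s ∈ S, ∃ s' ∈ S, s ≠ s' ∧ s - s' ∈ Submodule.span ℝ {e} := by
  by_contra! hcon
  obtain ⟨he, a, ha, hae, η, hηe, hη⟩ := h
  -- Perturbing `η` by `ζ` singles out one point of `S` but stays constant along `e`, so `a + r` and
  -- `a + e + r` would both be that point.
  obtain ⟨ζ, hζe, hζ⟩ := exists_dual_ne_zero_of_notMem_span e (Δ := (S - S) \ {0})
    (hS.sub hS).sdiff (by
      rintro _ ⟨⟨s, hs, s', hs', rfl⟩, hne⟩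
      exact hcon s hs s' hs' (by simpa [sub_eq_zero] using hne))
  have hinj : InjOn ζ S := by
    intro x hx y hy hxy
    by_contra hne
    exact hζ (x - y) ⟨sub_mem_sub hx hy, by simpa [sub_eq_zero] using hne⟩ (by simp [hxy])
  obtain ⟨s, hs⟩ := exists_eventually_uniqueMax hS hSne η hinj
  have hQmax : ∀ᶠ t : ℝ in 𝓝[>] 0, ∀ x ∈ Q, (η + t • ζ) x ≤ (η + t • ζ) a := by
    rw [eventually_all_finite hQ]
    intro x hx
    rcases hη x hx with hlt | ⟨c, rfl⟩
    · filter_upwards [eventually_add_mul_pos (y := ζ a - ζ x) (sub_pos.2 hlt)] with t ht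
      simp only [add_apply, smul_apply, smul_eq_mul]
      linarith
    · exact Eventually.of_forall fun t => by simp [hηe, hζe]
  obtain ⟨t, hts, htQ⟩ := (hs.and hQmax).exists
  set ψ : StrongDual ℝ E := η + t • ζ with hψ
  have hψe : ψ e = 0 := by simp [hψ, hηe, hζe]
  obtain ⟨r, hr, hrmax⟩ := hR.exists_isMaxOn hRne ψ.continuous.continuousOn
  have hle : ∀ x ∈ convexHull ℝ (Q + R), ψ x ≤ ψ (a + r) := by
    intro x hx
    refine convexHull_min (t := {y | ψ y ≤ ψ (a + r)}) ?_
      (convex_halfSpace_le ψ.toLinearMap.isLinear _) hx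
    rintro _ ⟨x, hx, y, hy, rfl⟩
    have h1 := htQ x hx
    have h2 : ψ y ≤ ψ r := hrmax hy
    simp only [mem_ofPred_eq, map_add]
    linarith
  have hsc := hts.convexHull_right
  rw [hconv] at hle
  have hsle := hle s hsc.1
  have h1 : a + r = s := hsc.eq_of_le
    (hconv ▸ subset_convexHull ℝ _ (add_mem_add ha hr)) hsle
  have h2 : a + e + r = s := hsc.eq_of_le
    (hconv ▸ subset_convexHull ℝ _ (add_mem_add hae hr)) (by simpa [hψe] using hsle)
  apply he
  rw [← h1] at h2
  have h3 := add_right_cancel h2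
  simpa using h3

/-! ### Eigenvectors of powers -/

/-- On the `α`-eigenspace of `M ^ N`, `M` is a root of the separable polynomial `X ^ N - α`, hence
diagonalizable, and all its eigenvalues there have `k`-th power `β`. -/
theorem pow_apply_eq_smul_of_forall_hasEigenvalue {V : Type*} [AddCommGroup V] [Module ℂ V]
    [FiniteDimensional ℂ V] (M : Module.End ℂ V) {α β : ℂ} {N k : ℕ} (hN : N ≠ 0) (hα : α ≠ 0)
    (h : ∀ u : ℂ, M.HasEigenvalue u → u ^ N = α → u ^ k = β) {x : V} (hx : (M ^ N) x = α • x) :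
    (M ^ k) x = β • x := by
  set W : Submodule ℂ V := Module.End.eigenspace (M ^ N) α with hW
  have hmaps : ∀ w ∈ W, M w ∈ W := by
    intro w hw
    rw [hW, Module.End.mem_eigenspace_iff] at hw ⊢
    rw [← map_smul, ← hw, ← Module.End.mul_apply, ← Module.End.mul_apply, ← pow_succ, ← pow_succ']
  set f : Module.End ℂ W := M.restrict hmaps with hf
  have hpow : ∀ (l : ℕ) (w : W), (((f ^ l) w : W) : V) = (M ^ l) w := by
    intro l w
    rw [hf, Module.End.pow_restrict l, LinearMap.coe_restrict_apply]
  have hss : f.IsSemisimple := by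
    refine Module.End.isSemisimple_of_squarefree_aeval_eq_zero
      (p := Polynomial.X ^ N - Polynomial.C α) ?_ ?_
    · exact (Polynomial.separable_X_pow_sub_C α (Nat.cast_ne_zero.2 hN) hα).squarefree
    · ext w
      have hw := Module.End.mem_eigenspace_iff.1 w.2
      simp [hpow, hw]
  have htop : (⊤ : Submodule ℂ W) ≤ LinearMap.ker (f ^ k - algebraMap ℂ _ β) := by
    rw [← hss.iSup_eigenspace_eq_top]
    refine iSup_le fun u w hw => ?_
    by_cases hw0 : w = 0
    · simp [hw0]
    have hv : f.HasEigenvector u w := ⟨hw, hw0⟩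
    have hMv : M.HasEigenvector u (w : V) := by
      refine ⟨Module.End.mem_eigenspace_iff.2 ?_, fun h0 => hw0 (Subtype.ext h0)⟩
      have := congrArg Subtype.val hv.apply_eq_smul
      simpa [hf] using this
    have huN : u ^ N = α := by
      have h1 := hMv.pow_apply N
      rw [Module.End.mem_eigenspace_iff.1 w.2] at h1
      exact (smul_left_injective ℂ hMv.2 h1).symm
    have huk := h u (Module.End.hasEigenvalue_of_hasEigenvector hMv) huN
    simp [LinearMap.mem_ker, hv.pow_apply k, huk, Module.algebraMap_end_apply]
  have hxW : x ∈ W := Module.End.mem_eigenspace_iff.2 hx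
  have := htop (Submodule.mem_top (x := (⟨x, hxW⟩ : W)))
  rw [LinearMap.mem_ker, LinearMap.sub_apply, sub_eq_zero] at this
  have := congrArg Subtype.val this
  rw [hpow] at this
  simpa [Module.algebraMap_end_apply] using this

theorem act_pow {n : ℕ} (T : Matrix (Fin n) (Fin n) ℝ) (i : ℕ) : act (T ^ i) = act T ^ i :=
  map_pow _ _ _

theorem act_apply_ofLp {n : ℕ} (T : Matrix (Fin n) (Fin n) ℝ) (x : EuclideanSpace ℝ (Fin n)) :
    (act T x).ofLp = T.mulVec x.ofLp :=
  Matrix.ofLp_toEuclideanCLM T x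

/-- If the elements `u` of `unityEigenvalues T` are such that `u ^ k` is real and nonnegative, then
every real eigenvector of a power of `T` is an eigenvector of `T ^ k` with positive eigenvalue. -/
theorem exists_pos_pow_act_eq_smul {n : ℕ} {T : Matrix (Fin n) (Fin n) ℝ} (hT : IsUnit T.det)
    {k : ℕ} (hk : ∀ u ∈ unityEigenvalues T, u ^ k = ((‖u‖ ^ k : ℝ) : ℂ))
    {N : ℕ} (hN : N ≠ 0) {r : ℝ} (hr : r ≠ 0) {e : EuclideanSpace ℝ (Fin n)}
    (he : (act T ^ N) e = r • e) : ∃ μ : ℝ, 0 < μ ∧ (act T ^ k) e = μ • e := by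
  -- The common modulus of all `u` with `u ^ N = r⁻¹`.
  set c : ℝ := |r⁻¹| ^ ((N : ℝ)⁻¹) with hc
  have hrpos : 0 < |r⁻¹| := abs_pos.2 (inv_ne_zero hr)
  have hcpos : 0 < c := Real.rpow_pos_of_pos hrpos _
  have hcN : c ^ N = |r⁻¹| := Real.rpow_inv_natCast_pow hrpos.le hN
  set M : Matrix (Fin n) (Fin n) ℂ := T⁻¹.map ((↑) : ℝ → ℂ) with hM
  set x : Fin n → ℂ := fun i => (e.ofLp i : ℂ) with hx
  have hinvpow : ∀ (j : ℕ) (s : ℝ), s ≠ 0 →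
      ((act T ^ j) e = s • e ↔ (Matrix.toLin' M ^ j) x = ((s⁻¹ : ℝ) : ℂ) • x) := by
    intro j s hs
    have hdet : IsUnit (T ^ j).det := by rw [Matrix.det_pow]; exact hT.pow j
    have h1 : (Matrix.toLin' M ^ j) x = fun i => (((T⁻¹ ^ j).mulVec e.ofLp i : ℝ) : ℂ) := by
      rw [← Matrix.toLin'_pow, Matrix.toLin'_apply]
      have h2 : M ^ j = (T⁻¹ ^ j).map (Complex.ofRealHom) :=
        (map_pow (Complex.ofRealHom.mapMatrix) T⁻¹ j).symm
      rw [h2]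
      ext i
      exact (RingHom.map_mulVec Complex.ofRealHom (T⁻¹ ^ j) e.ofLp i).symm
    have h3 : (act T ^ j) e = s • e ↔ (T ^ j).mulVec e.ofLp = s • e.ofLp := by
      rw [← act_pow, ← act_apply_ofLp, ← WithLp.ofLp_smul 2]
      exact (WithLp.ofLp_injective 2).eq_iff.symm
    have h4 : (Matrix.toLin' M ^ j) x = ((s⁻¹ : ℝ) : ℂ) • x ↔
        (T⁻¹ ^ j).mulVec e.ofLp = s⁻¹ • e.ofLp := by
      rw [h1, funext_iff, funext_iff]
      refine forall_congr' fun i => ?_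
      simp only [hx, Pi.smul_apply, smul_eq_mul, ← Complex.ofReal_mul, Complex.ofReal_inj]
    rw [h3, h4, Matrix.inv_pow']
    constructor
    · intro h
      have := congrArg (fun v => s⁻¹ • ((T ^ j)⁻¹).mulVec v) h
      simp only [Matrix.mulVec_mulVec, Matrix.nonsing_inv_mul _ hdet, Matrix.one_mulVec,
        Matrix.mulVec_smul, smul_smul, inv_mul_cancel₀ hs, one_smul] at this
      exact this.symm
    · intro h
      have := congrArg (fun v => s • (T ^ j).mulVec v) h
      simp only [Matrix.mulVec_mulVec, Matrix.mul_nonsing_inv _ hdet, Matrix.one_mulVec,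
        Matrix.mulVec_smul, smul_smul, mul_inv_cancel₀ hs, one_smul] at this
      exact this.symm
  refine ⟨(c ^ k)⁻¹, inv_pos.2 (pow_pos hcpos k), ?_⟩
  rw [hinvpow k _ (inv_ne_zero (pow_pos hcpos k).ne'), inv_inv]
  refine pow_apply_eq_smul_of_forall_hasEigenvalue (Matrix.toLin' M) hN
    (Complex.ofReal_ne_zero.2 (inv_ne_zero hr)) ?_ ((hinvpow N r hr).1 he)
  intro u hu huN
  have hnorm : ‖u‖ = c := by
    refine (pow_left_inj₀ (norm_nonneg u) hcpos.le hN).1 ?_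
    rw [← norm_pow, huN, hcN, Complex.norm_real, Real.norm_eq_abs]
  have hmem : u ∈ unityEigenvalues T := by
    -- The exponent is doubled because `r` may be negative.
    refine ⟨hu, c, u / c, 2 * N, hcpos.le, by omega, ?_, ?_⟩
    · rw [mul_comm, pow_mul, div_pow, huN, ← Complex.ofReal_pow, hcN, ← Complex.ofReal_div,
        ← Complex.ofReal_pow, div_pow, sq_abs, div_self (pow_ne_zero 2 (inv_ne_zero hr)),
        Complex.ofReal_one]
    · rw [mul_div_cancel₀]
      exact Complex.ofReal_ne_zero.2 hcpos.ne'
  rw [hk u hmem, hnorm]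

theorem pow_eq_norm_pow_of_mem_unityEigenvalues {n : ℕ} {T : Matrix (Fin n) (Fin n) ℝ} {m : ℕ}
    {c : Fin m → ℝ} {z : Fin m → ℂ} {ν : Fin m → ℕ} (hc : ∀ s, 0 ≤ c s) (hν : ∀ s, 1 ≤ ν s)
    (hz : ∀ s, z s ^ (2 * ν s) = 1)
    (hU : unityEigenvalues T = Set.range fun s => (c s : ℂ) * z s) :
    ∀ u ∈ unityEigenvalues T, u ^ (2 * ∏ s, ν s) = ((‖u‖ ^ (2 * ∏ s, ν s) : ℝ) : ℂ) := by
  rw [hU]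
  rintro _ ⟨s, rfl⟩
  have hz1 : ‖z s‖ = 1 := Complex.norm_eq_one_of_pow_eq_one (hz s) (by have := hν s; omega)
  obtain ⟨t, ht⟩ := Nat.mul_dvd_mul_left 2 (Finset.dvd_prod_of_mem ν (Finset.mem_univ s))
  simp only [mul_pow, norm_mul, hz1, Complex.norm_real, Real.norm_of_nonneg (hc s),
    mul_one, Complex.ofReal_pow]
  rw [ht, pow_mul (z s), hz, one_pow, mul_one]


/-! ### Partial sums and persistence of refinement -/

/-- The Minkowski sum of `L D, L² D, …, Lⁱ D`. -/
def partialSum (L : E →L[ℝ] E) (D : Set E) : ℕ → Set E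
  | 0 => {0}
  | i + 1 => partialSum L D i + (L ^ (i + 1) : E →L[ℝ] E) '' D

theorem image_pow_succ (L : E →L[ℝ] E) (D : Set E) (i : ℕ) :
    (L ^ (i + 1) : E →L[ℝ] E) '' D = L '' ((L ^ i : E →L[ℝ] E) '' D) := by
  rw [image_image]
  refine image_congr' fun x => ?_
  rw [pow_succ']
  rfl

theorem partialSum_succ_eq_image (L : E →L[ℝ] E) (D : Set E) (i : ℕ) :
    partialSum L D (i + 1) = L '' D + L '' partialSum L D i := by
  induction i with
  | zero => simp [partialSum]
  | succ i ih =>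
    have h : partialSum L D (i + 2) = partialSum L D (i + 1) + (L ^ (i + 2) : E →L[ℝ] E) '' D := rfl
    have h' : partialSum L D (i + 1) = partialSum L D i + (L ^ (i + 1) : E →L[ℝ] E) '' D := rfl
    rw [h, ih, image_pow_succ L D (i + 1), add_assoc, ← image_add, ← h', ← ih]

theorem finite_partialSum (L : E →L[ℝ] E) {D : Set E} (hD : D.Finite) (i : ℕ) :
    (partialSum L D i).Finite := by
  induction i with
  | zero => exact finite_singleton 0
  | succ i ih => exact ih.add (hD.image _)

theorem zero_mem_partialSum (L : E →L[ℝ] E) {D : Set E} (h0 : (0 : E) ∈ D) (i : ℕ) :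
    (0 : E) ∈ partialSum L D i := by
  induction i with
  | zero => exact mem_singleton 0
  | succ i ih => exact ⟨0, ih, 0, ⟨0, h0, map_zero _⟩, add_zero 0⟩

theorem eq_partialSum_add {L : E →L[ℝ] E} {D F : Set E} (hF : F = L '' D + L '' F) (i : ℕ) :
    F = partialSum L D i + (L ^ i : E →L[ℝ] E) '' F := by
  induction i with
  | zero => simp [partialSum]
  | succ i ih =>
    conv_lhs => rw [hF, ih, image_add, ← add_assoc, ← partialSum_succ_eq_image]
    rw [image_pow_succ]

theorem injective_pow {L : E →L[ℝ] E} (hL : Function.Injective L) (i : ℕ) :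
    Function.Injective (L ^ i : E →L[ℝ] E) := by
  induction i with
  | zero => exact Function.injective_id
  | succ i ih =>
    rw [pow_succ]
    exact ih.comp hL

theorem FanRefines.partialSum_of_le {L : E →L[ℝ] E} (hL : Function.Injective L) {D : Set E}
    {i : ℕ} (h : FanRefines (partialSum L D i) ((L ^ (i + 1) : E →L[ℝ] E) '' D)) {l : ℕ}
    (hl : i ≤ l) : FanRefines (partialSum L D l) ((L ^ (l + 1) : E →L[ℝ] E) '' D) := by
  induction l, hl using Nat.le_induction with
  | base => exact h
  | succ l _ ih =>
    rw [partialSum_succ_eq_image, image_pow_succ]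
    exact (ih.image hL).add_left _

/-- Only some power `L ^ K` is known to contract, so limits are taken along multiples of `K`. -/
theorem tendsto_pow_mul_apply {L : E →L[ℝ] E} {K : ℕ} (hK : ‖L ^ K‖ < 1) {f : ℕ → E} {C : ℝ}
    (hf : ∀ l, ‖f l‖ ≤ C) : Tendsto (fun l => (L ^ (K * l)) (f l)) atTop (𝓝 0) := by
  have hlim : Tendsto (fun l : ℕ => ‖L ^ K‖ ^ l * C) atTop (𝓝 0) := by
    simpa using (tendsto_pow_atTop_nhds_zero_of_lt_one (norm_nonneg _) hK).mul_const C
  refine squeeze_zero_norm' ?_ hlim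
  filter_upwards [eventually_gt_atTop 0] with l hl
  refine (ContinuousLinearMap.le_opNorm _ _).trans ?_
  rw [pow_mul]
  exact mul_le_mul (norm_pow_le' _ hl) (hf l) (norm_nonneg _) (by positivity)

/-! ### The attractor and its convex hull -/

section Attractor

variable {L : E →L[ℝ] E} {D F : Set E} {K : ℕ}

theorem zero_mem_attractor (hFne : F.Nonempty) (hFc : IsCompact F) (hF : F = L '' D + L '' F)
    (h0 : (0 : E) ∈ D) (hK : ‖L ^ K‖ < 1) : (0 : E) ∈ F := by
  obtain ⟨f, hf⟩ := hFne
  refine hFc.isClosed.mem_of_tendsto (tendsto_pow_mul_apply hK (f := fun _ => f) fun _ => le_rfl)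
    (Eventually.of_forall fun l => ?_)
  rw [eq_partialSum_add hF (K * l)]
  exact ⟨0, zero_mem_partialSum L h0 _, _, mem_image_of_mem _ hf, zero_add _⟩

theorem partialSum_subset_attractor (hFne : F.Nonempty) (hFc : IsCompact F)
    (hF : F = L '' D + L '' F) (h0 : (0 : E) ∈ D) (hK : ‖L ^ K‖ < 1) (i : ℕ) :
    partialSum L D i ⊆ F := by
  intro x hx
  rw [eq_partialSum_add hF i]
  exact ⟨x, hx, 0, ⟨0, zero_mem_attractor hFne hFc hF h0 hK, map_zero _⟩, add_zero x⟩

theorem exists_finite_convexHull_eq [FiniteDimensional ℝ E] (hL : Function.Injective L)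
    (hD : D.Finite) (hFne : F.Nonempty) (hFc : IsCompact F) (hF : F = L '' D + L '' F)
    (h0 : (0 : E) ∈ D) (hK0 : 0 < K) (hK : ‖L ^ K‖ < 1) {i : ℕ}
    (h : FanRefines (partialSum L D i) ((L ^ (i + 1) : E →L[ℝ] E) '' D)) :
    ∃ S : Set E, S.Finite ∧ convexHull ℝ F = convexHull ℝ S := by
  set V : ℕ → Set E := fun l => (convexHull ℝ (partialSum L D l)).extremePoints ℝ with hV
  have hVsub : ∀ l, V l ⊆ partialSum L D l := fun l => extremePoints_convexHull_subset
  have hVfin : ∀ l, (V l).Finite := fun l => (finite_partialSum L hD l).subset (hVsub l)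
  have hcard : ∀ l, i ≤ l → (V l).ncard = (V i).ncard := by
    intro l hl
    induction l, hl using Nat.le_induction with
    | base => rfl
    | succ l hl ih =>
      rw [← ih]
      exact ((ncard_extremePoints_add_eq_iff (finite_partialSum L hD l) (hD.image _)
        ⟨_, mem_image_of_mem _ h0⟩).2 (h.partialSum_of_le hL hl)).symm
  have henum : ∀ l, ∃ x : Fin (V i).ncard → E, i ≤ l → range x = V l := by
    intro l
    by_cases hl : i ≤ l
    · have hc : (hVfin l).toFinset.card = (V i).ncard := by
        rw [← hcard l hl, ncard_eq_toFinset_card _ (hVfin l)]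
      refine ⟨fun j => ((Finset.equivFinOfCardEq hc).symm j : E), fun _ => ?_⟩
      have := (Finset.equivFinOfCardEq hc).symm.surjective.range_comp (Subtype.val)
      simp only [Subtype.range_coe_subtype, Finite.mem_toFinset] at this
      exact this
    · exact ⟨fun _ => 0, fun h => absurd h hl⟩
  choose x hx using henum
  -- Multiples of `K` make the remainder vanish; the shift by `i` keeps the index where the vertex
  -- count is constant.
  set y : ℕ → Fin (V i).ncard → E := fun l => x (K * (l + i)) with hy
  have hle : ∀ l, i ≤ K * (l + i) := fun l =>
    le_trans (by omega) (Nat.le_mul_of_pos_left (l + i) hK0)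
  have hPF := partialSum_subset_attractor hFne hFc hF h0 hK
  -- The vertices, listed by a fixed finite index set, converge along a subsequence; their limits
  -- span the hull of `F`.
  obtain ⟨p, hp, σ, hσ, hlim⟩ := (isCompact_univ_pi fun _ : Fin (V i).ncard => hFc).tendsto_subseq
    (x := y) (fun l j _ => hPF _ (hVsub _ ((hx _ (hle l)) ▸ mem_range_self j)))
  refine ⟨range p, finite_range p, (convexHull_min ?_ (convex_convexHull ℝ _)).antisymm
    (convexHull_mono ?_)⟩
  · intro f hf
    by_contra hnot
    obtain ⟨φ, u, hφ, hu⟩ := geometric_hahn_banach_closed_point (convex_convexHull ℝ (range p))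
      ((finite_range p).isCompact_convexHull ℝ).isClosed hnot
    have hdec : ∀ l, ∃ a ∈ partialSum L D (K * l), ∃ g ∈ F, a + (L ^ (K * l)) g = f := by
      intro l
      rw [eq_partialSum_add hF (K * l)] at hf
      obtain ⟨a, ha, _, ⟨g, hg, rfl⟩, hag⟩ := hf
      exact ⟨a, ha, g, hg, hag⟩
    choose a ha g hg hag using hdec
    obtain ⟨C, hC⟩ := hFc.isBounded.exists_norm_le
    have hτ : Tendsto (fun l => σ l + i) atTop atTop :=
      tendsto_atTop_mono (fun l => Nat.le_add_right _ i) hσ.tendsto_atTop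
    have hat : Tendsto (fun l => φ (a (σ l + i))) atTop (𝓝 (φ f)) := by
      have h1 := (tendsto_pow_mul_apply hK fun l => hC _ (hg l)).comp hτ
      have h2 : Tendsto (fun l => f - (L ^ (K * (σ l + i))) (g (σ l + i))) atTop (𝓝 (f - 0)) :=
        tendsto_const_nhds.sub h1
      rw [sub_zero] at h2
      refine (φ.continuous.tendsto f).comp (h2.congr fun l => ?_)
      exact sub_eq_of_eq_add (hag _).symm
    have hev : ∀ᶠ l in atTop, ∀ j, φ (y (σ l) j) < u := by
      rw [eventually_all]
      intro j
      have h1 : Tendsto (fun l => φ (y (σ l) j)) atTop (𝓝 (φ (p j))) :=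
        (φ.continuous.tendsto _).comp ((tendsto_pi_nhds.1 hlim) j)
      exact h1.eventually_lt_const (hφ _ (subset_convexHull ℝ _ (mem_range_self j)))
    have hev' : ∀ᶠ l in atTop, φ (a (σ l + i)) ≤ u := by
      filter_upwards [hev] with l hl
      have h1 : a (σ l + i) ∈ convexHull ℝ (V (K * (σ l + i))) := by
        rw [hV, convexHull_extremePoints_convexHull (finite_partialSum L hD _)]
        exact subset_convexHull ℝ _ (ha _)
      rw [← hx _ (hle (σ l))] at h1
      refine convexHull_min (t := {w | φ w ≤ u}) ?_
        (convex_halfSpace_le φ.toLinearMap.isLinear u) h1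
      rintro _ ⟨j, rfl⟩
      exact (hl j).le
    exact absurd (le_of_tendsto hat hev') (not_le.2 hu)
  · rintro _ ⟨j, rfl⟩
    exact hp j (mem_univ j)

/-- If the convex hull of the attractor is a polytope, then each edge vector of `D` is an
eigenvector of a power of `L`. -/
theorem IsEdgeVector.exists_pow_apply_eq_smul [FiniteDimensional ℝ E] (hL : Function.Injective L)
    (hD : D.Finite) (hFne : F.Nonempty) (hFc : IsCompact F) (hF : F = L '' D + L '' F)
    (h0 : (0 : E) ∈ D) {S : Set E} (hS : S.Finite) (hconv : convexHull ℝ F = convexHull ℝ S)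
    {e : E} (he : IsEdgeVector D e) : ∃ (N : ℕ) (r : ℝ), N ≠ 0 ∧ r ≠ 0 ∧ (L ^ N) e = r • e := by
  have hSne : S.Nonempty := by
    rw [← convexHull_nonempty_iff (𝕜 := ℝ), ← hconv, convexHull_nonempty_iff]
    exact hFne
  have hspan : ∀ i : ℕ, ∃ p : S × S, ∃ c : ℝ, c ≠ 0 ∧ (L ^ (i + 1)) e = c • ((p.1 : E) - p.2) := by
    intro i
    have hsum : (L ^ (i + 1) : E →L[ℝ] E) '' D +
        (partialSum L D i + (L ^ (i + 1) : E →L[ℝ] E) '' F) = F := by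
      conv_rhs => rw [eq_partialSum_add hF (i + 1), partialSum]
      rw [← add_assoc, add_comm (_ '' D)]
    obtain ⟨s, hs, s', hs', hne, hmem⟩ :=
      (he.image (injective_pow hL (i + 1))).exists_sub_mem_span (S := S)
        (R := partialSum L D i + (L ^ (i + 1) : E →L[ℝ] E) '' F) (hD.image _)
        ((finite_partialSum L hD i).isCompact.add (hFc.image (L ^ (i + 1)).continuous))
        (Nonempty.add ⟨0, zero_mem_partialSum L h0 i⟩ (hFne.image _)) hS hSne
        (by rw [hsum, hconv])
    obtain ⟨c, hc⟩ := Submodule.mem_span_singleton.1 hmem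
    have hc0 : c ≠ 0 := by
      rintro rfl
      rw [zero_smul] at hc
      exact hne (sub_eq_zero.1 hc.symm)
    refine ⟨(⟨s, hs⟩, ⟨s', hs'⟩), c⁻¹, inv_ne_zero hc0, ?_⟩
    rw [← hc, smul_smul, inv_mul_cancel₀ hc0, one_smul]
  choose p c hc hp using hspan
  have := hS.to_subtype
  -- Two images of `e` are parallel to the same difference of points of `S`; cancelling `L ^ (i +
  -- 1)` leaves an eigenvector of `L ^ (j - i)`.
  obtain ⟨i, j, hij, hpij⟩ := Finite.exists_ne_map_eq_of_infinite p
  wlog hlt : i < j generalizing i j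
  · exact this j i hij.symm hpij.symm (lt_of_le_of_ne (not_lt.1 hlt) hij.symm)
  refine ⟨j - i, c j * (c i)⁻¹, (Nat.sub_pos_of_lt hlt).ne', mul_ne_zero (hc j)
    (inv_ne_zero (hc i)), injective_pow hL (i + 1) ?_⟩
  have h1 : (L ^ (i + 1)) ((L ^ (j - i)) e) = (L ^ (j + 1)) e := by
    have : L ^ (j + 1) = L ^ (i + 1) * L ^ (j - i) := by
      rw [← pow_add]
      congr 1
      omega
    rw [this]
    rfl
  rw [h1, map_smul, hp j, hp i, hpij, smul_smul, mul_assoc, inv_mul_cancel₀ (hc i), mul_one]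

end Attractor

/-! ### Positively scaled edges give refinement -/

/-- If `φ` peaks on `D` at `a`, it decreases along the edges leaving `a`; so does `φ ∘ f`, which
therefore also has its maximum at `a`. -/
theorem fanRefines_image_of_forall_isEdgeVector {D : Set E} (hD : D.Finite) {f : E →L[ℝ] E}
    (h : ∀ e, IsEdgeVector D e → ∃ μ : ℝ, 0 < μ ∧ f e = μ • e) : FanRefines D (f '' D) := by
  have key : ∀ (φ : StrongDual ℝ E) (a b : E), UniqueMax φ D a → UniqueMax φ (f '' D) b →
      f a = b := by
    intro φ a b ha hb
    obtain ⟨b, hbD, rfl⟩ := hb.1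
    refine hb.eq_of_le (mem_image_of_mem f ha.1) ?_
    refine ha.le_of_forall_isEdgeVector (g := φ.comp f) hD (fun x _ hxa hedge => ?_) hbD
    obtain ⟨μ, hμ, hμe⟩ := h _ hedge
    rw [ContinuousLinearMap.comp_apply, hμe, map_smul, smul_eq_mul, map_sub]
    exact mul_nonpos_of_nonneg_of_nonpos hμ.le (by linarith)
  intro φ ψ a b b' h1 h2 h3 h4
  rw [← key φ a b h1 h3, key ψ a b' h2 h4]

theorem fanRefines_partialSum {L : E →L[ℝ] E} (hL : Function.Injective L) {D : Set E}
    (hD : D.Finite) {k : ℕ} (hk : k ≠ 0)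
    (h : ∀ e, IsEdgeVector D e → ∃ μ : ℝ, 0 < μ ∧ (L ^ k) e = μ • e) :
    FanRefines (partialSum L D k) ((L ^ (k + 1) : E →L[ℝ] E) '' D) := by
  obtain ⟨l, rfl⟩ := Nat.exists_eq_succ_of_ne_zero hk
  -- As `k ≥ 1`, `L '' D` is a summand of the partial sum, and its fan already refines that of `L ^
  -- (k + 1) '' D`.
  rw [Nat.succ_eq_add_one, partialSum_succ_eq_image, image_pow_succ, add_comm (L '' D)]
  exact ((fanRefines_image_of_forall_isEdgeVector hD h).image hL).add_left _

/-! ### Specialization to a single matrix -/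

theorem wordProd_const {n q : ℕ} (T : Matrix (Fin n) (Fin n) ℝ) {k : ℕ} (j : Fin k → Fin q) :
    wordProd (fun _ : Fin q => T) j = T ^ k := by
  simp [wordProd]

theorem approx_eq_partialSum {n q : ℕ} (T : Matrix (Fin n) (Fin n) ℝ)
    (d : Fin q → EuclideanSpace ℝ (Fin n)) (i : ℕ) :
    approx (fun _ : Fin q => T) d i = partialSum (act T) (range d) i := by
  induction i with
  | zero =>
    ext x
    simp [approx, partialSum]
  | succ i ih =>
    rw [partialSum, ← ih]
    ext x
    simp only [approx, wordProd_const, act_pow, Fin.sum_univ_castSucc, Set.mem_add, mem_image,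
      mem_range, mem_ofPred_eq]
    constructor
    · rintro ⟨j, rfl⟩
      exact ⟨_, ⟨fun l => j l.castSucc, rfl⟩, _, ⟨_, ⟨j (Fin.last i), rfl⟩, rfl⟩, rfl⟩
    · rintro ⟨_, ⟨j, rfl⟩, _, ⟨_, ⟨l, rfl⟩, rfl⟩, rfl⟩
      exact ⟨Fin.snoc j l, by simp⟩

theorem exists_norm_pow_lt_one {n q : ℕ} (hq : 0 < q) {T : Matrix (Fin n) (Fin n) ℝ}
    (h : jointSpectralRadius (fun _ : Fin q => T) < 1) : ∃ K : ℕ, 0 < K ∧ ‖act T ^ K‖ < 1 := by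
  have : Nonempty (Fin q) := ⟨⟨0, hq⟩⟩
  obtain ⟨K, hK⟩ := exists_lt_of_ciInf_lt h
  refine ⟨K, K.pos, ?_⟩
  simp only [wordProd_const, act_pow, ciSup_const] at hK
  by_contra! hge
  exact hK.not_ge (Real.one_le_rpow hge (by positivity))

theorem IsSelfAffineSet.eq_add {n q : ℕ} {T : Matrix (Fin n) (Fin n) ℝ}
    {d : Fin q → EuclideanSpace ℝ (Fin n)} {F : Set (EuclideanSpace ℝ (Fin n))}
    (hF : IsSelfAffineSet (fun _ : Fin q => T) d F) : F = act T '' range d + act T '' F := by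
  conv_lhs => rw [hF.eq_iUnion]
  ext x
  simp only [mem_iUnion, mem_image, Set.mem_add, mem_range]
  constructor
  · rintro ⟨j, f, hf, rfl⟩
    exact ⟨_, ⟨_, ⟨j, rfl⟩, rfl⟩, _, ⟨f, hf, rfl⟩, by rw [map_add, add_comm]⟩
  · rintro ⟨_, ⟨_, ⟨j, rfl⟩, rfl⟩, _, ⟨f, hf, rfl⟩, rfl⟩
    exact ⟨j, f, hf, by rw [map_add, add_comm]⟩

theorem injective_act {n : ℕ} {T : Matrix (Fin n) (Fin n) ℝ} (hT : IsUnit T.det) :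
    Function.Injective (act T) := by
  intro x y hxy
  have h : T.mulVec x.ofLp = T.mulVec y.ofLp := by
    rw [← act_apply_ofLp, ← act_apply_ofLp, hxy]
  exact WithLp.ofLp_injective 2
    (Matrix.mulVec_injective_of_isUnit ((Matrix.isUnit_iff_isUnit_det T).2 hT) h)

end SelfAffine

theorem theorem1 {n q : ℕ} (hq : 0 < q)
    (T : Matrix (Fin n) (Fin n) ℝ) (hT : IsUnit T.det)
    (hrad : SelfAffine.jointSpectralRadius (fun _ : Fin q => T) < 1)
    (d : Fin q → EuclideanSpace ℝ (Fin n)) (hd : d ⟨0, hq⟩ = 0)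
    (F : Set (EuclideanSpace ℝ (Fin n)))
    (hF : SelfAffine.IsSelfAffineSet (fun _ : Fin q => T) d F)
    (hne : (SelfAffine.unityEigenvalues T).Nonempty)
    (m : ℕ) (c : Fin m → ℝ) (z : Fin m → ℂ) (ν : Fin m → ℕ)
    (hc : ∀ s, 0 ≤ c s) (hν : ∀ s, 1 ≤ ν s) (hz : ∀ s, z s ^ (2 * ν s) = 1)
    (hU : SelfAffine.unityEigenvalues T = Set.range fun s => (c s : ℂ) * z s)
    (k : ℕ) (hk : k = 2 * ∏ s, ν s) :
    ((∀ i, 1 ≤ i → i ≤ k →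
        (SelfAffine.vertices (fun _ : Fin q => T) d i).ncard ≠
          (SelfAffine.vertices (fun _ : Fin q => T) d (i + 1)).ncard) →
      ¬ SelfAffine.IsPolytope (convexHull ℝ F)) ∧
    (SelfAffine.IsPolytope (convexHull ℝ F) ↔
      ∃ i, 1 ≤ i ∧ i ≤ k ∧
        (SelfAffine.vertices (fun _ : Fin q => T) d i).ncard =
          (SelfAffine.vertices (fun _ : Fin q => T) d (i + 1)).ncard) := by
  have hL := SelfAffine.injective_act hT
  have hD : (Set.range d).Finite := Set.finite_range d
  have h0 : (0 : EuclideanSpace ℝ (Fin n)) ∈ Set.range d := ⟨_, hd⟩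
  have hFeq := hF.eq_add
  obtain ⟨K, hK0, hK⟩ := SelfAffine.exists_norm_pow_lt_one hq hrad
  have hcard : ∀ i, (SelfAffine.vertices (fun _ : Fin q => T) d i).ncard =
      (SelfAffine.vertices (fun _ : Fin q => T) d (i + 1)).ncard ↔
      SelfAffine.FanRefines (SelfAffine.partialSum (SelfAffine.act T) (Set.range d) i)
        ((SelfAffine.act T ^ (i + 1) :
          EuclideanSpace ℝ (Fin n) →L[ℝ] EuclideanSpace ℝ (Fin n)) '' Set.range d) := by
    intro i
    rw [SelfAffine.vertices, SelfAffine.vertices, SelfAffine.approx_eq_partialSum,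
      SelfAffine.approx_eq_partialSum]
    exact SelfAffine.ncard_extremePoints_add_eq_iff (SelfAffine.finite_partialSum _ hD i)
      (hD.image _) ⟨_, Set.mem_image_of_mem _ h0⟩
  have hk1 : 1 ≤ k := by
    have : 0 < ∏ s, ν s := Finset.prod_pos fun s _ => hν s
    omega
  have hkpow := SelfAffine.pow_eq_norm_pow_of_mem_unityEigenvalues hc hν hz hU
  rw [← hk] at hkpow
  -- For a polytope the index `k` itself always gives equality.
  have hforward : SelfAffine.IsPolytope (convexHull ℝ F) →
      (SelfAffine.vertices (fun _ : Fin q => T) d k).ncard =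
        (SelfAffine.vertices (fun _ : Fin q => T) d (k + 1)).ncard := by
    rintro ⟨S, hS, hconv⟩
    refine (hcard k).2 (SelfAffine.fanRefines_partialSum hL hD (by omega) fun e he => ?_)
    obtain ⟨N, r, hN, hr, hNe⟩ :=
      he.exists_pow_apply_eq_smul hL hD hF.nonempty hF.isCompact hFeq h0 hS hconv
    exact SelfAffine.exists_pos_pow_act_eq_smul hT hkpow hN hr hNe
  refine ⟨fun h hP => h k hk1 le_rfl (hforward hP), fun hP => ⟨k, hk1, le_rfl, hforward hP⟩, ?_⟩
  rintro ⟨i, -, -, hi⟩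
  exact SelfAffine.exists_finite_convexHull_eq hL hD hF.nonempty hF.isCompact hFeq h0 hK0 hK
    ((hcard i).1 hi)
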